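/- \textbf{Definitions.} Let $S=S[1]\cdots S[n]$ be a string over any alphabet. A nonempty substring $S[i..j]$ is a \emph{maximal palindrome} of $S$ if it is a palindrome and $i=1$, or $j=n$, or $S[i-1]\neq S[j+1]$. The \emph{palindromic fingerprint} of $S$ is $PF(S)=\{(i,j): i<j,\ S[i..j]\text{ is a maximal palindrome of }S\}$. A pair $(F,n)$ with $F\subseteq\mathbb N\times\mathbb N$ is a \emph{valid fingerprint} if some string $S$ of length $n$ satisfies $PF(S)=F$; every such $S$ is a \emph{preimage} of $(F,n)$. The alphabet size of a string is the number of distinct characters that occur in it. \textbf{The greedy algorithm} (I et al.) takes a valid fingerprint $(F,n)$ and writes a string $S[1]\cdots S[n]$ over the ordered characters $0<1<2<\cdots$ from left to right, with the following rule for $i=1,\dots,n$. \begin{itemize} \item If some $(b,e)\in F$ has $\frac{b+e}{2}<i\le e$, then $S[i]:=S[b+e-i]$ for such a pair $(b,e)$. \item Otherwise $S[i]$ is the smallest character different from $S[q]$ for all $1\le q<i$ such that $(q+1,i-1)\in F$, or $q=i-2$, or $q=i-1$. (In particular, a new character is introduced only when all the characters used so far are forbidden, and then it is the smallest new one.) \end{itemize}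 \textbf{Lemma.} Let $(F,n)$ be a valid fingerprint. \begin{enumerate} \item Every string $S$ that results from the greedy rule, whichever pairs $(b,e)$ it copies from, is a preimage of $(F,n)$ over a minimum-size alphabet: $PF(S)=F$, and every preimage $T$ of $(F,n)$, over any alphabet, contains at least as many distinct characters as $S$. \item The greedy rule is carried out in linear time: there are a random access machine program (with unit-cost reading, writing, addition, subtraction and comparison of natural numbers) and a constant $C$ such that for every valid fingerprint $(F,n)$, given as $n$ and a list of the pairs of $F$ in any order without repetition, the program halts after at most $C(n+1)$ steps, and its output is a string that results from the greedy rule; hence it is a preimage of $(F,n)$ over a minimum-size alphabet. \end{enumerate} -/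

import Mathlib

universe u v

namespace PalFingerprint

/-! ### Strings, maximal palindromes and fingerprints

A string is a list; positions are counted from `1`, so the character at position `p` of `S`
is `S[p - 1]?`. -/

/-- The substring `S[i..j]` (positions from `1`, both ends included). -/
def substr {α : Type*} (S : List α) (i j : ℕ) : List α := (S.take j).drop (i - 1)

/-- `S[i..j]` is a nonempty maximal palindrome of `S`: it is a palindrome and it cannot be extended,
because it touches an end of `S` or because the characters at the positions `i - 1` and `j + 1`
differ. -/
def IsMaximalPalindrome {α : Type*} (S : List α) (i j : ℕ) : Prop :=
  1 ≤ i ∧ i ≤ j ∧ j ≤ S.length ∧ (substr S i j).Palindrome ∧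
    (i = 1 ∨ j = S.length ∨ S[(i - 1) - 1]? ≠ S[(j + 1) - 1]?)

/-- The palindromic fingerprint of `S`: the nontrivial (of length at least two) maximal
palindromes of `S`, as pairs (start, end). -/
def PF {α : Type*} (S : List α) : Set (ℕ × ℕ) :=
  {p | p.1 < p.2 ∧ IsMaximalPalindrome S p.1 p.2}

/-- `S` is a preimage of `(F, n)`, that is, it reconstructs the fingerprint `F` of length `n`. -/
def IsPreimage {α : Type*} (F : Set (ℕ × ℕ)) (n : ℕ) (S : List α) : Prop :=
  S.length = n ∧ PF S = F

/-- `(F, n)` is a valid palindromic fingerprint: some string reconstructs it. -/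
def IsValid (F : Set (ℕ × ℕ)) (n : ℕ) : Prop :=
  ∃ (α : Type u) (T : List α), IsPreimage F n T

/-- The size of the alphabet of `S`: the number of characters that occur in `S`. -/
noncomputable def alphabetSize {α : Type*} (S : List α) : ℕ := {c | c ∈ S}.ncard

/-! ### The greedy left-to-right reconstruction

The characters are `0 < 1 < 2 < …`. -/

/-- Position `i` lies in the right half of the palindrome `p = (b, e)`
(strictly to the right of its center `(b + e) / 2`); its mirror image is `b + e - i`. -/
def InRightHalf (p : ℕ × ℕ) (i : ℕ) : Prop := p.1 + p.2 < 2 * i ∧ i ≤ p.2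

/-- The character `c` is forbidden at position `i`: it stands at an earlier position `q` such that
the palindrome `(q + 1, i - 1)` is maximal. For a position `i` in the right half of no palindrome
of `F`, these are the palindromes of `F` that end at `i - 1`, the one-letter palindrome
(`q + 1 = i - 1`) and the empty palindrome (`q + 1 = i`). -/
def Forbidden (F : Set (ℕ × ℕ)) (S : List ℕ) (i c : ℕ) : Prop :=
  ∃ q, 1 ≤ q ∧ q < i ∧ ((q + 1, i - 1) ∈ F ∨ q + 1 = i - 1 ∨ q + 1 = i) ∧ S[q - 1]? = some c

/-- `S` is a result of the greedy reconstruction of `(F, n)`: at each position, from left to right,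
a position in the right half of a palindrome of `F` copies the character from its mirror image in
such a palindrome; every other position gets the smallest character that is not forbidden there. -/
def IsGreedyReconstruction (F : Set (ℕ × ℕ)) (n : ℕ) (S : List ℕ) : Prop :=
  S.length = n ∧ ∀ i, 1 ≤ i → i ≤ n →
    (∃ p ∈ F, InRightHalf p i ∧ S[i - 1]? = S[p.1 + p.2 - i - 1]?) ∨
    ((∀ p ∈ F, ¬ InRightHalf p i) ∧
      ∃ c, S[i - 1]? = some c ∧ IsLeast {x | ¬ Forbidden F S i x} c)

/-! ### A random access machine with a step count

A small imperative language over numbered registers and numbered arrays of natural numbers. -/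

/-- Expressions. -/
inductive Expr : Type
  | const (k : ℕ)
  | reg (x : ℕ)
  | get (a : ℕ) (e : Expr)
  | add (e₁ e₂ : Expr)
  | sub (e₁ e₂ : Expr)
  | le (e₁ e₂ : Expr)
  | eq (e₁ e₂ : Expr)

/-- Commands. A test succeeds if its value is not `0`. -/
inductive Cmd : Type
  | skip
  | assign (x : ℕ) (e : Expr)
  | store (a : ℕ) (idx e : Expr)
  | seq (c₁ c₂ : Cmd)
  | ite (test : Expr) (c₁ c₂ : Cmd)
  | loop (test : Expr) (c : Cmd)

/-- The memory: the contents of the registers and of the arrays. -/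
structure Memory where
  reg : ℕ → ℕ
  arr : ℕ → ℕ → ℕ

/-- The value of an expression. -/
def Expr.eval (s : Memory) : Expr → ℕ
  | .const k => k
  | .reg x => s.reg x
  | .get a e => s.arr a (e.eval s)
  | .add e₁ e₂ => e₁.eval s + e₂.eval s
  | .sub e₁ e₂ => e₁.eval s - e₂.eval s
  | .le e₁ e₂ => if e₁.eval s ≤ e₂.eval s then 1 else 0
  | .eq e₁ e₂ => if e₁.eval s = e₂.eval s then 1 else 0

/-- The cost of evaluating an expression: one step for every operation in it. -/
def Expr.cost : Expr → ℕ
  | .const _ => 1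
  | .reg _ => 1
  | .get _ e => e.cost + 1
  | .add e₁ e₂ => e₁.cost + e₂.cost + 1
  | .sub e₁ e₂ => e₁.cost + e₂.cost + 1
  | .le e₁ e₂ => e₁.cost + e₂.cost + 1
  | .eq e₁ e₂ => e₁.cost + e₂.cost + 1

/-- Write `v` to register `x`. -/
def Memory.setReg (s : Memory) (x v : ℕ) : Memory :=
  { s with reg := Function.update s.reg x v }

/-- Write `v` to the cell `k` of array `a`. -/
def Memory.setArr (s : Memory) (a k v : ℕ) : Memory :=
  { s with arr := Function.update s.arr a (Function.update (s.arr a) k v) }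

/-- `Exec c s t s'`: the command `c`, started in memory `s`, halts after exactly `t` steps
in memory `s'`. -/
inductive Exec : Cmd → Memory → ℕ → Memory → Prop
  | skip (s : Memory) : Exec .skip s 1 s
  | assign (s : Memory) (x : ℕ) (e : Expr) :
      Exec (.assign x e) s (e.cost + 1) (s.setReg x (e.eval s))
  | store (s : Memory) (a : ℕ) (idx e : Expr) :
      Exec (.store a idx e) s (idx.cost + e.cost + 1) (s.setArr a (idx.eval s) (e.eval s))
  | seq {s s₁ s₂ : Memory} {t₁ t₂ : ℕ} {c₁ c₂ : Cmd} :
      Exec c₁ s t₁ s₁ → Exec c₂ s₁ t₂ s₂ → Exec (.seq c₁ c₂) s (t₁ + t₂) s₂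
  | ite_true {s s₁ : Memory} {t : ℕ} {test : Expr} {c₁ c₂ : Cmd} :
      test.eval s ≠ 0 → Exec c₁ s t s₁ → Exec (.ite test c₁ c₂) s (test.cost + t + 1) s₁
  | ite_false {s s₁ : Memory} {t : ℕ} {test : Expr} {c₁ c₂ : Cmd} :
      test.eval s = 0 → Exec c₂ s t s₁ → Exec (.ite test c₁ c₂) s (test.cost + t + 1) s₁
  | loop_done {s : Memory} {test : Expr} {c : Cmd} :
      test.eval s = 0 → Exec (.loop test c) s (test.cost + 1) s
  | loop_step {s s₁ s₂ : Memory} {t₁ t₂ : ℕ} {test : Expr} {c : Cmd} :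
      test.eval s ≠ 0 → Exec c s t₁ s₁ → Exec (.loop test c) s₁ t₂ s₂ →
        Exec (.loop test c) s (test.cost + t₁ + t₂ + 1) s₂

/-! ### The greedy algorithm as a program -/

/-- Run the commands of a list one after the other. -/
def block : List Cmd → Cmd
  | [] => .skip
  | c :: l => .seq c (block l)

/-- Register: the length `n`. -/
abbrev rN : ℕ := 0
/-- Register: the number of pairs in the input. -/
abbrev rM : ℕ := 1
/-- Register: index of an input pair. -/
abbrev rK : ℕ := 2
/-- Register: the current position. -/
abbrev rI : ℕ := 3
/-- Register: `start + end` of the palindrome that reaches furthest to the right so far. -/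
abbrev rSum : ℕ := 4
/-- Register: the end of that palindrome. -/
abbrev rEnd : ℕ := 5
/-- Register: pointer into a linked list of input pairs (`0` is the null pointer). -/
abbrev rPtr : ℕ := 6
/-- Register: candidate character. -/
abbrev rX : ℕ := 7

/-- Array (input): the start of the `k`-th pair. -/
abbrev aStart : ℕ := 0
/-- Array (input): the end of the `k`-th pair. -/
abbrev aEnd : ℕ := 1
/-- Array: the end of the palindrome `(b, e)` of the input with `b + e = k`, or `0`. -/
abbrev aCen : ℕ := 2
/-- Array: the head of the linked list of the pairs that end at a given position. -/
abbrev aHead : ℕ := 3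
/-- Array: the successor of a pair in its linked list. -/
abbrev aNext : ℕ := 4
/-- Array: the last position at which a given character was forbidden. -/
abbrev aMark : ℕ := 5
/-- Array (output): the character at a given position. -/
abbrev aOut : ℕ := 6

/-- First phase: index the input pairs by their centers and by their ends. -/
def indexPhase : Cmd := block [
  .assign rK (.const 0),
  .loop (.le (.add (.reg rK) (.const 1)) (.reg rM)) (block [
    .store aCen (.add (.get aStart (.reg rK)) (.get aEnd (.reg rK))) (.get aEnd (.reg rK)),
    .store aNext (.reg rK) (.get aHead (.get aEnd (.reg rK))),
    .store aHead (.get aEnd (.reg rK)) (.add (.reg rK) (.const 1)),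
    .assign rK (.add (.reg rK) (.const 1))])]

/-- Let the palindrome with `start + end = sum` become the current one if it ends further right. -/
def tryCenter (sum : Expr) : Cmd :=
  .ite (.le (.add (.reg rEnd) (.const 1)) (.get aCen sum))
    (block [.assign rEnd (.get aCen sum), .assign rSum sum]) .skip

/-- Mark the character at position `pos` as forbidden at the current position. -/
def forbidCharAt (pos : Expr) : Cmd := .store aMark (.get aOut pos) (.reg rI)

/-- The character at the current position is not forced: mark the forbidden characters and write
the smallest character that is not marked. -/
def freeStep : Cmd := block [
  .ite (.le (.const 2) (.reg rI)) (forbidCharAt (.sub (.reg rI) (.const 1))) .skip,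
  .ite (.le (.const 3) (.reg rI)) (forbidCharAt (.sub (.reg rI) (.const 2))) .skip,
  .assign rPtr (.get aHead (.sub (.reg rI) (.const 1))),
  .loop (.reg rPtr) (block [
    .ite (.le (.const 2) (.get aStart (.sub (.reg rPtr) (.const 1))))
      (forbidCharAt (.sub (.get aStart (.sub (.reg rPtr) (.const 1))) (.const 1))) .skip,
    .assign rPtr (.get aNext (.sub (.reg rPtr) (.const 1)))]),
  .assign rX (.const 0),
  .loop (.eq (.get aMark (.reg rX)) (.reg rI)) (.assign rX (.add (.reg rX) (.const 1))),
  .store aOut (.reg rI) (.reg rX)]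

/-- Second phase: write the string from left to right. -/
def writePhase : Cmd := block [
  .assign rSum (.const 0),
  .assign rEnd (.const 0),
  .assign rI (.const 1),
  .loop (.le (.reg rI) (.reg rN)) (block [
    tryCenter (.sub (.add (.reg rI) (.reg rI)) (.const 2)),
    tryCenter (.sub (.add (.reg rI) (.reg rI)) (.const 1)),
    .ite (.le (.reg rI) (.reg rEnd))
      (.store aOut (.reg rI) (.get aOut (.sub (.reg rSum) (.reg rI))))
      freeStep,
    .assign rI (.add (.reg rI) (.const 1))])]

/-- The greedy reconstruction algorithm. -/
def greedyProgram : Cmd := .seq indexPhase writePhase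

/-- The initial memory on input `(L, n)`: the number `n`, the length of `L` and the pairs in `L`;
everything else is `0`. -/
def inputMemory (L : List (ℕ × ℕ)) (n : ℕ) : Memory where
  reg x := if x = rN then n else if x = rM then L.length else 0
  arr a k :=
    if a = aStart then (L.getD k (0, 0)).1
    else if a = aEnd then (L.getD k (0, 0)).2
    else 0

/-- The string of length `n` that stands in the output array (in the cells `1, …, n`). -/
def outputString (s : Memory) (n : ℕ) : List ℕ := (List.range n).map fun k => s.arr aOut (k + 1)

end PalFingerprint

/-! Let `T` be any preimage and `S` any greedy result. The core observation (`eq_iff_palOn`)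
concerns two positions `q < p` that both precede palindromes ending at `i - 1`: reflecting the
situation at `p` in the longer palindrome shows that their characters agree exactly when
`[q..q+i-p]` is a palindrome, and this interval ends before `i`. So equality of such characters is
determined by the palindromes among the first `i - 1` positions.

It follows by induction on the prefix length that `S` and `T` have the same palindromes
(`IsGreedyReconstruction.samePal`). If position `i` is copied, then in both strings its character
equals that of a mirror position, which precedes a palindrome ending at `i - 1`, and the observation
applies. If `i` is free, no palindrome of length at least two ends at `i` in `T`, since its maximal
extension would have `i` in its right half; the forbidden characters rule out the same palindromes
in `S`. Equal palindromes give equal fingerprints.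

For minimality, a freely chosen `c` has all of `0, …, c - 1` forbidden. The positions that forbid
them carry pairwise distinct characters in `T` as well, and `T` has yet another one at `i`, so `T`
has more than `c` characters. Copying creates no new characters.

For the running time, distinct pairs have distinct sums `b + e`, so there are at most `2n` of them.
Whether `i` lies in a right half is decided by the furthest end among palindromes with sum below
`2i`, a maximum updated with two new sums per position. A free position costs time proportional to
one plus the number of palindromes ending just before it: the least unmarked character is at most
the number of marks, and marks are stamped with the position, so they need no clearing. Summed over
all positions this is linear. -/

namespace PalFingerprint

/-! ### Palindromes in terms of positions -/

/-- The character at position `p` (from `1`). -/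
def charAt {α : Type*} (S : List α) (p : ℕ) : Option α := S[p - 1]?

/-- `f` reads the same in both directions on the positions `i, …, j`. -/
def PalOn {α : Type*} (f : ℕ → α) (i j : ℕ) : Prop :=
  ∀ k, i ≤ k → k ≤ j → f k = f (i + j - k)

theorem palOn_of_le {α : Type*} (f : ℕ → α) {i j : ℕ} (h : j ≤ i) : PalOn f i j := by
  intro k h1 h2
  congr 1
  omega

theorem palOn_iff_step {α : Type*} (f : ℕ → α) {i j : ℕ} (h : i < j) :
    PalOn f i j ↔ f i = f j ∧ PalOn f (i + 1) (j - 1) := by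
  constructor
  · intro H
    refine ⟨?_, fun k h1 h2 => ?_⟩
    · have := H i le_rfl h.le
      rwa [Nat.add_sub_cancel_left] at this
    · have := H k (by omega) (by omega)
      rwa [show i + 1 + (j - 1) - k = i + j - k by omega]
  · rintro ⟨h0, H⟩ k h1 h2
    rcases h1.eq_or_lt with rfl | h1
    · rwa [Nat.add_sub_cancel_left]
    rcases h2.eq_or_lt with rfl | h2
    · rw [Nat.add_sub_cancel]; exact h0.symm
    · have := H k (by omega) (by omega)
      rwa [show i + 1 + (j - 1) - k = i + j - k by omega] at this

theorem PalOn.of_subinterval {α : Type*} {f : ℕ → α} {b e i j : ℕ} (H : PalOn f b e)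
    (h : b + e = i + j) (hb : b ≤ i) : PalOn f i j := by
  intro k h1 h2
  rw [← h]
  exact H k (by omega) (by omega)

theorem substr_palindrome_iff {α : Type*} (S : List α) {i j : ℕ} (hi : 1 ≤ i) (hij : i ≤ j)
    (hj : j ≤ S.length) : (substr S i j).Palindrome ↔ PalOn (charAt S) i j := by
  have hlen : (substr S i j).length = j + 1 - i := by
    simp only [substr, List.length_drop, List.length_take]; omega
  have hget : ∀ k, k < j + 1 - i → (substr S i j)[k]? = charAt S (i + k) := by
    intro k hk
    simp only [substr, charAt, List.getElem?_drop, List.getElem?_take]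
    rw [if_pos (by omega)]
    congr 1
    omega
  have hrev : ∀ k, k < j + 1 - i → (substr S i j).reverse[k]? = charAt S (j - k) := by
    intro k hk
    rw [List.getElem?_reverse (by omega), hlen, hget _ (by omega)]
    congr 1
    omega
  rw [List.Palindrome.iff_reverse_eq]
  constructor
  · intro H k h1 h2
    have e1 := hget (k - i) (by omega)
    rw [← H, hrev _ (by omega)] at e1
    rw [show i + (k - i) = k by omega, show j - (k - i) = i + j - k by omega] at e1
    exact e1.symm
  · intro H
    refine List.ext_getElem? fun k => ?_
    by_cases hk : k < j + 1 - i
    · rw [hrev k hk, hget k hk, H (i + k) (by omega) (by omega)]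
      congr 1
      omega
    · rw [List.getElem?_eq_none (by rw [List.length_reverse]; omega),
        List.getElem?_eq_none (by omega)]

theorem mem_PF_iff {α : Type*} (S : List α) (i j : ℕ) :
    (i, j) ∈ PF S ↔ 1 ≤ i ∧ i < j ∧ j ≤ S.length ∧ PalOn (charAt S) i j ∧
      (i = 1 ∨ j = S.length ∨ charAt S (i - 1) ≠ charAt S (j + 1)) := by
  constructor
  · rintro ⟨h, h1, h2, h3, h4, h5⟩
    exact ⟨h1, h, h3, (substr_palindrome_iff S h1 h2 h3).1 h4, h5⟩
  · rintro ⟨h1, h, h3, h4, h5⟩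
    exact ⟨h, h1, h.le, h3, (substr_palindrome_iff S h1 h.le h3).2 h4, h5⟩

/-- Every palindrome of length at least two extends to a maximal one with the same center. -/
theorem exists_mem_PF {α : Type*} (S : List α) {i j : ℕ} (hi : 1 ≤ i) (hij : i < j)
    (hj : j ≤ S.length) (H : PalOn (charAt S) i j) :
    ∃ b e, (b, e) ∈ PF S ∧ b + e = i + j ∧ j ≤ e := by
  induction i generalizing j with
  | zero => omega
  | succ i ih =>
    -- If the palindrome is not maximal, it extends by one position on both sides; the start
    -- decreases, which drives the induction.
    by_cases hm : i + 1 = 1 ∨ j = S.length ∨ charAt S i ≠ charAt S (j + 1)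
    · exact ⟨i + 1, j, (mem_PF_iff S _ _).2 ⟨hi, hij, hj, H, hm⟩, rfl, le_rfl⟩
    · push Not at hm
      obtain ⟨h1, h2, h3⟩ := hm
      obtain ⟨b, e, h, hs, he⟩ := ih (j := j + 1) (by omega) (by omega) (by omega)
        ((palOn_iff_step _ (by omega)).2 ⟨h3, H⟩)
      exact ⟨b, e, h, by omega, by omega⟩

/-- The sum of start and end determines a pair of a fingerprint. -/
theorem eq_of_mem_PF_of_add_eq {α : Type*} {S : List α} {p q : ℕ × ℕ} (hp : p ∈ PF S)
    (hq : q ∈ PF S) (h : p.1 + p.2 = q.1 + q.2) : p = q := by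
  wlog hle : p.1 ≤ q.1 generalizing p q
  · exact (this hq hp h.symm (by omega)).symm
  obtain ⟨b, e⟩ := p
  obtain ⟨i, j⟩ := q
  simp only at h hle
  obtain ⟨h1, h2, h3, h4, -⟩ := (mem_PF_iff S b e).1 hp
  obtain ⟨k1, k2, k3, k4, k5⟩ := (mem_PF_iff S i j).1 hq
  rcases hle.eq_or_lt with rfl | hlt
  · rw [Nat.add_left_cancel h]
  · exfalso
    rcases k5 with k5 | k5 | k5
    · omega
    · omega
    -- The shorter palindrome lies strictly inside a concentric one, whose symmetry equates its two
    -- neighbours, against maximality.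
    · have := h4 (i - 1) (by omega) (by omega)
      rw [show b + e - (i - 1) = j + 1 by omega] at this
      exact k5 this

/-- `f` and `g` have the same palindromes among the positions `1, …, m`. -/
def SamePal {α β : Type*} (f : ℕ → α) (g : ℕ → β) (m : ℕ) : Prop :=
  ∀ a b, 1 ≤ a → b ≤ m → (PalOn f a b ↔ PalOn g a b)

/-- Away from the ends of the string, a palindrome `[i..j]` fails to be maximal exactly when
`[i-1..j+1]` is a palindrome too, so maximality is itself a statement about palindromes. -/
theorem PF_eq_of_samePal {α β : Type*} {S : List α} {T : List β} (hlen : S.length = T.length)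
    (H : SamePal (charAt S) (charAt T) S.length) : PF S = PF T := by
  ext ⟨i, j⟩
  rw [mem_PF_iff, mem_PF_iff, ← hlen]
  refine and_congr_right fun h1 => and_congr_right fun h2 => and_congr_right fun h3 => ?_
  rw [H i j h1 h3]
  refine and_congr_right fun h4 => ?_
  by_cases hi : i = 1
  · simp [hi]
  by_cases hj : j = S.length
  · simp [hj]
  have h5 := H (i - 1) (j + 1) (by omega) (by omega)
  rw [palOn_iff_step (charAt S) (show i - 1 < j + 1 by omega),
      palOn_iff_step (charAt T) (show i - 1 < j + 1 by omega), Nat.sub_add_cancel h1,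
      Nat.add_sub_cancel, H i j h1 h3, and_iff_left h4, and_iff_left h4] at h5
  simp only [hi, hj, false_or, ne_eq, h5]

/-- Two characters that precede palindromes ending at the same position are equal if and only if
a shorter palindrome starts at the first of them. -/
theorem eq_iff_palOn {α : Type*} {f : ℕ → α} {q p i : ℕ} (hqp : q < p) (hpi : p < i)
    (hq : PalOn f (q + 1) (i - 1)) (hp : PalOn f (p + 1) (i - 1)) :
    f q = f p ↔ PalOn f q (q + i - p) := by
  have hmir : f p = f (q + i - p) := by
    have := hq p (by omega) (by omega)
    rwa [show q + 1 + (i - 1) - p = q + i - p by omega] at this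
  -- The palindromic suffix `[p+1..i-1]` of the palindrome `[q+1..i-1]` is reflected onto a prefix
  -- of it: reflect in the long one, in the suffix, and in the long one again.
  have hpre : PalOn f (q + 1) (q + i - p - 1) := by
    intro k h1 h2
    have e1 := hq k (by omega) (by omega)
    have e2 := hq (q + 1 + (q + i - p - 1) - k) (by omega) (by omega)
    have e3 := hp (q + 1 + (i - 1) - k) (by omega) (by omega)
    rw [e1, e2, e3]
    congr 1
    omega
  rw [palOn_iff_step f (by omega), ← hmir, and_iff_left hpre]

/-- Transfers equality of characters between strings over different alphabets: the palindrome that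
decides it ends before `i`, where the two strings have the same palindromes. -/
theorem SamePal.eq_iff_eq {α β : Type*} {f : ℕ → α} {g : ℕ → β} {i q p : ℕ}
    (H : SamePal f g (i - 1)) (hq1 : 1 ≤ q) (hp1 : 1 ≤ p) (hqi : q < i) (hpi : p < i)
    (hq : PalOn f (q + 1) (i - 1)) (hp : PalOn f (p + 1) (i - 1)) :
    f q = f p ↔ g q = g p := by
  wlog hqp : q < p generalizing q p
  · rcases (not_lt.1 hqp).eq_or_lt with rfl | h
    · simp
    · rw [eq_comm, this hp1 hq1 hpi hqi hp hq h, eq_comm]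
  rw [eq_iff_palOn hqp hpi hq hp, H _ _ hq1 (by omega), ← eq_iff_palOn hqp hpi
    ((H _ _ (by omega) le_rfl).1 hq) ((H _ _ (by omega) le_rfl).1 hp)]

/-! ### The greedy reconstruction is a preimage -/

section Greedy

variable {β : Type*} {F : Set (ℕ × ℕ)} {n : ℕ} {S : List ℕ} {T : List β}

theorem forbidden_iff (i c : ℕ) : Forbidden F S i c ↔
    ∃ q, 1 ≤ q ∧ q < i ∧ ((q + 1, i - 1) ∈ F ∨ q + 1 = i - 1 ∨ q + 1 = i) ∧
      charAt S q = some c := Iff.rfl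

theorem palOn_of_forbidding (hT : IsPreimage F n T) {q i : ℕ}
    (h : (q + 1, i - 1) ∈ F ∨ q + 1 = i - 1 ∨ q + 1 = i) :
    PalOn (charAt T) (q + 1) (i - 1) := by
  rcases h with h | h | h
  · rw [← hT.2, mem_PF_iff] at h
    exact h.2.2.2.1
  · exact palOn_of_le _ (by omega)
  · exact palOn_of_le _ (by omega)

/-- At a position in the right half of no palindrome of `F`, the character of a preimage differs
from each character that precedes a palindrome ending just before that position. -/
theorem ne_of_not_inRightHalf (hT : IsPreimage F n T) {q i : ℕ} (hq : 1 ≤ q) (hqi : q < i)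
    (hi : i ≤ n) (hF : ∀ p ∈ F, ¬ InRightHalf p i) (hpal : PalOn (charAt T) (q + 1) (i - 1)) :
    charAt T q ≠ charAt T i := by
  intro heq
  obtain ⟨b, e, h, hs, he⟩ := exists_mem_PF T hq hqi (hT.1.symm ▸ hi)
    ((palOn_iff_step _ hqi).2 ⟨heq, hpal⟩)
  rw [hT.2] at h
  exact hF _ h ⟨by simp only; omega, he⟩

theorem IsGreedyReconstruction.samePal (hS : IsGreedyReconstruction F n S)
    (hT : IsPreimage F n T) {m : ℕ} (hm : m ≤ n) : SamePal (charAt S) (charAt T) m := by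
  induction m with
  | zero =>
    intro a b h1 h2
    exact iff_of_true (palOn_of_le _ (by omega)) (palOn_of_le _ (by omega))
  | succ m ih =>
    replace ih := ih (by omega)
    intro q b hq hb
    rcases Nat.lt_or_ge b (m + 1) with hb' | hb'
    · exact ih q b hq (by omega)
    obtain rfl : b = m + 1 := by omega
    clear hb hb'
    rcases Nat.lt_or_ge q (m + 1) with hqm | hqm
    swap
    · exact iff_of_true (palOn_of_le _ (by omega)) (palOn_of_le _ (by omega))
    rw [palOn_iff_step _ hqm, palOn_iff_step _ hqm, ih _ _ (by omega) (by omega)]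
    refine and_congr_left fun hpal => ?_
    rcases hS.2 (m + 1) (by omega) hm with ⟨⟨b, e⟩, hF, ⟨hr1, hr2⟩, hcopy⟩ | ⟨hF, c, hc, hleast⟩
    · simp only at hr1 hr2
      change charAt S (m + 1) = charAt S (b + e - (m + 1)) at hcopy
      rw [← hT.2, mem_PF_iff] at hF
      obtain ⟨hb1, hbe, hen, hpalF, -⟩ := hF
      have hT' := hpalF (m + 1) (by omega) hr2
      -- Cutting the palindrome of `F` down to the positions strictly between `m + 1` and its mirror
      -- image shows that the mirror image also precedes a palindrome ending at `m`.
      have hmir : PalOn (charAt T) (b + e - (m + 1) + 1) (m + 1 - 1) :=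
        hpalF.of_subinterval (by omega) (by omega)
      rw [hcopy, hT']
      exact SamePal.eq_iff_eq (i := m + 1) ih hq (by omega) hqm (by omega)
        ((ih _ _ (by omega) (by omega)).2 hpal) ((ih _ _ (by omega) (by omega)).2 hmir)
    · have hne := ne_of_not_inRightHalf hT hq hqm hm hF hpal
      refine iff_of_false (fun heq => hleast.1 ?_) hne
      refine ⟨q, hq, hqm, ?_, heq.trans hc⟩
      -- If `[q+1..m]` has length at least two, it is maximal in `T` because its neighbours differ
      -- there, hence it is in `F`; length one and zero are the two other ways to forbid a
      -- character.
      by_cases h : q + 1 < m + 1 - 1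
      · left
        rw [← hT.2, mem_PF_iff]
        refine ⟨by omega, h, by rw [hT.1]; omega, hpal, Or.inr (Or.inr ?_)⟩
        rwa [Nat.add_sub_cancel, show m + 1 - 1 + 1 = m + 1 by omega]
      · omega

theorem IsGreedyReconstruction.isPreimage (hS : IsGreedyReconstruction F n S)
    (hT : IsPreimage F n T) : IsPreimage F n S :=
  ⟨hS.1, (PF_eq_of_samePal (hS.1.trans hT.1.symm)
    (hS.1.symm ▸ hS.samePal hT le_rfl)).trans hT.2⟩

/-! ### Minimality of the alphabet. -/

theorem finite_setOf_mem {α : Type*} (l : List α) : {a | a ∈ l}.Finite := l.finite_toSet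

/-- A character that the greedy rule chooses freely is smaller than the number of characters of
every preimage. -/
theorem lt_alphabetSize_of_isLeast (hS : IsGreedyReconstruction F n S) (hT : IsPreimage F n T)
    {i c : ℕ} (hi1 : 1 ≤ i) (hin : i ≤ n) (hF : ∀ p ∈ F, ¬ InRightHalf p i)
    (hc : IsLeast {x | ¬ Forbidden F S i x} c) : c < alphabetSize T := by
  have hforb : ∀ x, x < c → Forbidden F S i x := fun x hx => by
    by_contra h
    exact absurd (hc.2 h) (by omega)
  simp only [forbidden_iff] at hforb
  choose! pos hp1 hpi hpF hpc using hforb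
  have hsame : SamePal (charAt S) (charAt T) (i - 1) := hS.samePal hT (by omega)
  have hpalT : ∀ x, x < c → PalOn (charAt T) (pos x + 1) (i - 1) := fun x hx =>
    palOn_of_forbidding hT (hpF x hx)
  have hpalS : ∀ x, x < c → PalOn (charAt S) (pos x + 1) (i - 1) := fun x hx =>
    (hsame _ _ (by omega) le_rfl).2 (hpalT x hx)
  -- `g` lists `c + 1` positions: one that forbids each `x < c`, and `i` itself for `x = c`. Their
  -- characters in `T` are pairwise distinct.
  set g : ℕ → ℕ := fun x => if x < c then pos x else i with hg
  have hgle : ∀ x, 1 ≤ g x ∧ g x ≤ n := fun x => by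
    by_cases hx : x < c
    · simp only [hg, if_pos hx]
      exact ⟨hp1 x hx, by have := hpi x hx; omega⟩
    · simp only [hg, if_neg hx]
      exact ⟨hi1, hin⟩
  have hval : ∀ x, ∃ a ∈ T, charAt T (g x) = some a := fun x => by
    have := hgle x
    have hlt : g x - 1 < T.length := by rw [hT.1]; omega
    exact ⟨T[g x - 1], List.getElem_mem hlt, List.getElem?_eq_getElem hlt⟩
  choose φ hφT hφ using hval
  have hinj : ∀ x ≤ c, ∀ y ≤ c, x < y → φ x ≠ φ y := by
    intro x hx y hy hxy heq
    have h1 : charAt T (g x) = charAt T (g y) := by rw [hφ, hφ, heq]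
    have hxc : x < c := by omega
    rcases hy.eq_or_lt with rfl | hyc
    · simp only [hg, if_pos hxc, lt_irrefl, if_false] at h1
      exact ne_of_not_inRightHalf hT (hp1 x hxc) (hpi x hxc) hin hF (hpalT x hxc) h1
    · simp only [hg, if_pos hxc, if_pos hyc] at h1
      rw [← SamePal.eq_iff_eq hsame (hp1 x hxc) (hp1 y hyc) (hpi x hxc) (hpi y hyc)
        (hpalS x hxc) (hpalS y hyc), hpc x hxc, hpc y hyc] at h1
      exact absurd (Option.some.inj h1) (by omega)
  have hle := Set.ncard_le_ncard_of_injOn (s := (Finset.range (c + 1) : Set ℕ)) φ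
    (fun x _ => hφT x) (fun x hx y hy heq => by
      rw [Finset.mem_coe, Finset.mem_range] at hx hy
      rcases lt_trichotomy x y with h | h | h
      · exact absurd heq (hinj x (by omega) y (by omega) h)
      · exact h
      · exact absurd heq.symm (hinj y (by omega) x (by omega) h)) (finite_setOf_mem T)
  rw [Set.ncard_coe_finset, Finset.card_range] at hle
  exact hle

theorem IsGreedyReconstruction.alphabetSize_le (hS : IsGreedyReconstruction F n S)
    (hT : IsPreimage F n T) : alphabetSize S ≤ alphabetSize T := by
  have key : ∀ i, 1 ≤ i → i ≤ n → ∀ x, charAt S i = some x → x < alphabetSize T := by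
    intro i
    induction i using Nat.strong_induction_on with
    | _ i ih =>
      intro hi1 hin x hx
      rcases hS.2 i hi1 hin with ⟨⟨b, e⟩, hF, ⟨hr1, hr2⟩, hcopy⟩ | ⟨hF, c, hc, hleast⟩
      · rw [← hT.2, mem_PF_iff] at hF
        simp only at hr1 hr2
        exact ih (b + e - i) (by omega) (by omega) (by omega) x (hcopy.symm.trans hx)
      · obtain rfl : c = x := Option.some.inj (hc.symm.trans hx)
        exact lt_alphabetSize_of_isLeast hS hT hi1 hin hF hleast
  have hsub : {c | c ∈ S} ⊆ (Finset.range (alphabetSize T) : Set ℕ) := by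
    intro x hx
    obtain ⟨k, hk, rfl⟩ := List.getElem_of_mem hx
    rw [Finset.mem_coe, Finset.mem_range]
    exact key (k + 1) (by omega) (by rw [← hS.1]; omega) _ (List.getElem?_eq_getElem hk)
  have := Set.ncard_le_ncard hsub (Finset.finite_toSet _)
  rwa [Set.ncard_coe_finset, Finset.card_range] at this

end Greedy

/-! ### Bounded execution -/

/-- The command `c`, started in memory `s`, halts within `t` steps in a memory satisfying `Q`. -/
def Runs (c : Cmd) (s : Memory) (t : ℕ) (Q : Memory → Prop) : Prop :=
  ∃ t' s', Exec c s t' s' ∧ t' ≤ t ∧ Q s'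

namespace Runs

variable {c c₁ c₂ : Cmd} {s : Memory} {t t₁ t₂ : ℕ} {P Q : Memory → Prop} {test : Expr}

theorem mono (h : Runs c s t₁ P) (ht : t₁ ≤ t₂) (hPQ : ∀ s', P s' → Q s') : Runs c s t₂ Q := by
  obtain ⟨t, s', h1, h2, h3⟩ := h
  exact ⟨t, s', h1, h2.trans ht, hPQ s' h3⟩

theorem skip (h : Q s) : Runs .skip s 1 Q := ⟨1, s, .skip s, le_rfl, h⟩

theorem assign {x : ℕ} {e : Expr} (h : Q (s.setReg x (e.eval s))) :
    Runs (.assign x e) s (e.cost + 1) Q := ⟨_, _, .assign s x e, le_rfl, h⟩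

theorem store {a : ℕ} {idx e : Expr} (h : Q (s.setArr a (idx.eval s) (e.eval s))) :
    Runs (.store a idx e) s (idx.cost + e.cost + 1) Q := ⟨_, _, .store s a idx e, le_rfl, h⟩

theorem seq (h₁ : Runs c₁ s t₁ P) (h₂ : ∀ s', P s' → Runs c₂ s' t₂ Q) :
    Runs (.seq c₁ c₂) s (t₁ + t₂) Q := by
  obtain ⟨u₁, s₁, e₁, l₁, p₁⟩ := h₁
  obtain ⟨u₂, s₂, e₂, l₂, p₂⟩ := h₂ s₁ p₁
  exact ⟨_, _, .seq e₁ e₂, by omega, p₂⟩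

theorem assign_seq {x : ℕ} {e : Expr} (h : Runs c (s.setReg x (e.eval s)) t Q) :
    Runs (.seq (.assign x e) c) s (e.cost + 1 + t) Q :=
  (assign rfl).seq fun _ hs => hs ▸ h

theorem store_seq {a : ℕ} {idx e : Expr}
    (h : Runs c (s.setArr a (idx.eval s) (e.eval s)) t Q) :
    Runs (.seq (.store a idx e) c) s (idx.cost + e.cost + 1 + t) Q :=
  (store rfl).seq fun _ hs => hs ▸ h

theorem ite (h₁ : test.eval s ≠ 0 → Runs c₁ s t Q) (h₂ : test.eval s = 0 → Runs c₂ s t Q) :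
    Runs (.ite test c₁ c₂) s (test.cost + t + 1) Q := by
  by_cases h : test.eval s = 0
  · obtain ⟨u, s', e, l, q⟩ := h₂ h
    exact ⟨_, _, .ite_false h e, by omega, q⟩
  · obtain ⟨u, s', e, l, q⟩ := h₁ h
    exact ⟨_, _, .ite_true h e, by omega, q⟩

theorem loop_done (h : test.eval s = 0) (hQ : Q s) :
    Runs (.loop test c) s (test.cost + 1) Q := ⟨_, _, .loop_done h, le_rfl, hQ⟩

theorem loop_step (h : test.eval s ≠ 0) (h₁ : Runs c s t₁ P)
    (h₂ : ∀ s', P s' → Runs (.loop test c) s' t₂ Q) :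
    Runs (.loop test c) s (test.cost + t₁ + t₂ + 1) Q := by
  obtain ⟨u₁, s₁, e₁, l₁, p₁⟩ := h₁
  obtain ⟨u₂, s₂, e₂, l₂, p₂⟩ := h₂ s₁ p₁
  exact ⟨_, _, .loop_step h e₁ e₂, by omega, p₂⟩

/-- A loop whose `k`-th round takes at most `w k` steps and turns the invariant `I k` into
`I (k + 1)`. -/
theorem loop {I : ℕ → Memory → Prop} {w : ℕ → ℕ} {N : ℕ}
    (hstep : ∀ k s, k < N → I k s → test.eval s ≠ 0 ∧ Runs c s (w k) (I (k + 1)))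
    (hdone : ∀ s, I N s → test.eval s = 0) (h0 : I 0 s) :
    Runs (.loop test c) s (∑ k ∈ Finset.range N, w k + (N + 1) * (test.cost + 1)) (I N) := by
  -- The induction is on the number `d` of remaining rounds, starting from an arbitrary round `k`.
  suffices H : ∀ d k s, k + d = N → I k s →
      Runs (.loop test c) s (∑ j ∈ Finset.range d, w (k + j) + (d + 1) * (test.cost + 1)) (I N) by
    simpa using H N 0 s (by omega) h0
  intro d
  induction d with
  | zero =>
    intro k s hk hI
    obtain rfl : k = N := hk
    exact (loop_done (hdone s hI) hI).mono (by simp) fun _ h => h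
  | succ d ih =>
    intro k s hk hI
    obtain ⟨h1, h2⟩ := hstep k s (by omega) hI
    refine (loop_step h1 h2 fun s' hs' => ih (k + 1) s' (by omega) hs').mono ?_ fun _ h => h
    rw [Finset.sum_range_succ', add_one_mul (d + 1)]
    simp only [Nat.add_assoc, Nat.add_comm 1, Nat.add_zero]
    omega

end Runs

theorem Expr.eval_le_ne_zero_iff {s : Memory} {e₁ e₂ : Expr} :
    (Expr.le e₁ e₂).eval s ≠ 0 ↔ e₁.eval s ≤ e₂.eval s := by
  rw [Expr.eval]
  split_ifs with h <;> simp [h]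

/-! ### Linked lists of input pairs -/

/-- The pointer `p` leads to a linked list of the indices in `l`; the index `k` is represented by
the pointer `k + 1`. -/
def Linked (next : ℕ → ℕ) : ℕ → List ℕ → Prop
  | p, [] => p = 0
  | p, k :: l => p = k + 1 ∧ Linked next (next k) l

theorem Linked.congr {next next' : ℕ → ℕ} {l : List ℕ} {p : ℕ} (h : Linked next p l)
    (heq : ∀ k ∈ l, next' k = next k) : Linked next' p l := by
  induction l generalizing p with
  | nil => exact h
  | cons k l ih =>
    refine ⟨h.1, ?_⟩
    rw [heq k (by simp)]
    exact ih h.2 fun j hj => heq j (by simp [hj])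

/-- The indices below `K` of the pairs of `L` that end at `e`, in decreasing order. -/
def endIdx (L : List (ℕ × ℕ)) : ℕ → ℕ → List ℕ
  | 0, _ => []
  | K + 1, e => if (L.getD K (0, 0)).2 = e then K :: endIdx L K e else endIdx L K e

theorem mem_endIdx {L : List (ℕ × ℕ)} {K e k : ℕ} :
    k ∈ endIdx L K e ↔ k < K ∧ (L.getD k (0, 0)).2 = e := by
  induction K with
  | zero => simp [endIdx]
  | succ K ih =>
    rw [endIdx]
    split_ifs with h
    · rw [List.mem_cons, ih]
      constructor
      · rintro (rfl | h')
        · exact ⟨by omega, h⟩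
        · exact ⟨by omega, h'.2⟩
      · rintro ⟨h1, h2⟩
        rcases Nat.lt_succ_iff_lt_or_eq.1 h1 with h1 | h1
        · exact Or.inr ⟨h1, h2⟩
        · exact Or.inl h1
    · rw [ih]
      refine and_congr_left fun h2 => ?_
      have : k ≠ K := by rintro rfl; exact h h2
      omega

/-- Each index lies in at most one of the lists, the one of its end. This amortizes the list
traversals of the second phase. -/
theorem sum_length_endIdx_le (L : List (ℕ × ℕ)) (K n : ℕ) :
    ∑ e ∈ Finset.range n, (endIdx L K e).length ≤ K := by
  induction K with
  | zero => simp [endIdx]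
  | succ K ih =>
    have : ∀ e, (endIdx L (K + 1) e).length =
        (endIdx L K e).length + if (L.getD K (0, 0)).2 = e then 1 else 0 := by
      intro e
      rw [endIdx]
      split_ifs <;> simp
    simp only [this, Finset.sum_add_distrib]
    refine Nat.add_le_add ih ?_
    rw [Finset.sum_ite_eq]
    split_ifs <;> simp

/-! ### The first phase -/

/-- The memory after `K` rounds of the first phase. -/
structure IndexInv (L : List (ℕ × ℕ)) (n K : ℕ) (s : Memory) : Prop where
  regN : s.reg rN = n
  regM : s.reg rM = L.length
  regK : s.reg rK = K
  start : ∀ k, s.arr aStart k = (L.getD k (0, 0)).1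
  ends : ∀ k, s.arr aEnd k = (L.getD k (0, 0)).2
  cen : ∀ c, (s.arr aCen c = 0 ∧ ∀ k < K, (L.getD k (0, 0)).1 + (L.getD k (0, 0)).2 ≠ c) ∨
    ∃ k < K, (L.getD k (0, 0)).1 + (L.getD k (0, 0)).2 = c ∧
      s.arr aCen c = (L.getD k (0, 0)).2
  links : ∀ e, Linked (s.arr aNext) (s.arr aHead e) (endIdx L K e)
  mark : ∀ x, s.arr aMark x = 0

theorem runs_indexPhase (L : List (ℕ × ℕ)) (n : ℕ) :
    Runs indexPhase (inputMemory L n) (50 * (L.length + 1)) (IndexInv L n L.length) := by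
  unfold indexPhase
  simp only [block]
  refine (Runs.assign_seq (Runs.seq (Runs.loop (w := fun _ => 40) (I := IndexInv L n) (N := L.length) ?_ ?_ ?_) fun s hs =>
    Runs.skip hs)).mono ?_ fun _ h => h
  · intro K s hK h
    refine ⟨by simp [Expr.eval, h.regK, h.regM]; omega, ?_⟩
    refine (Runs.store_seq (Runs.store_seq (Runs.store_seq (Runs.assign_seq
      (Runs.skip ?_))))).mono (by simp [Expr.cost]) fun _ h => h
    constructor
    · simp [Memory.setReg, Memory.setArr, h.regN]
    · simp [Memory.setReg, Memory.setArr, h.regM]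
    · simp [Memory.setReg, Memory.setArr, Expr.eval, h.regK]
    · simp [Memory.setReg, Memory.setArr, h.start]
    · simp [Memory.setReg, Memory.setArr, h.ends]
    · intro c
      simp only [Memory.setReg, Memory.setArr, Expr.eval, h.regK, h.start, h.ends, ne_eq,
        OfNat.ofNat_eq_ofNat, Nat.reduceEqDiff, not_false_eq_true, Function.update_of_ne,
        OfNat.one_ne_ofNat, Nat.succ_ne_self, Function.update_self, Function.update_apply]
      split_ifs with hc
      · exact Or.inr ⟨K, by omega, hc.symm, rfl⟩
      · rcases h.cen c with ⟨h1, h2⟩ | ⟨k, h1, h2, h3⟩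
        · refine Or.inl ⟨h1, fun k hk => ?_⟩
          rcases Nat.lt_succ_iff_lt_or_eq.1 hk with hk | rfl
          · exact h2 k hk
          · exact fun h => hc h.symm
        · exact Or.inr ⟨k, by omega, h2, h3⟩
    · intro e
      simp only [Memory.setReg, Memory.setArr, Expr.eval, h.regK, h.ends, ne_eq,
        OfNat.ofNat_eq_ofNat, Nat.reduceEqDiff, not_false_eq_true, Function.update_of_ne,
        OfNat.one_ne_ofNat, Nat.succ_ne_self, Function.update_self,
        Function.update_apply (s.arr aHead)]
      -- The only successor cell written in this round is that of the fresh index `K`, so the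
      -- existing lists stay intact.
      have hnext : ∀ k ∈ endIdx L K e, k ≠ K := fun k hk => (mem_endIdx.1 hk).1.ne
      rw [endIdx]
      split_ifs with h1 h2 h2
      · refine ⟨rfl, ?_⟩
        rw [Function.update_self, ← h1]
        exact (h.links e).congr fun k hk => Function.update_of_ne (hnext k hk) _ _
      · exact absurd h1.symm h2
      · exact absurd h2.symm h1
      · exact (h.links e).congr fun k hk => Function.update_of_ne (hnext k hk) _ _
    · simp [Memory.setReg, Memory.setArr, h.mark]
  · intro s h
    simp [Expr.eval, h.regK, h.regM]
  · constructor <;> simp [Memory.setReg, inputMemory, Expr.eval, endIdx, Linked]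
  · simp [Expr.cost]
    omega

/-! ### The free step of the second phase -/

/-- The memory `s'` results from `s` by marking the characters in `D` as forbidden at position
`i`; besides the marks, only the pointer may have changed. -/
structure Marks (i : ℕ) (D : List ℕ) (s s' : Memory) : Prop where
  arr : ∀ a, a ≠ aMark → s'.arr a = s.arr a
  reg : ∀ r, r ≠ rPtr → s'.reg r = s.reg r
  mark : ∀ x, s'.arr aMark x = if x ∈ D then i else s.arr aMark x

theorem Marks.refl (i : ℕ) (s : Memory) : Marks i [] s s :=
  ⟨fun _ _ => rfl, fun _ _ => rfl, fun _ => by simp⟩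

theorem Marks.trans {i : ℕ} {D D' : List ℕ} {s s' s'' : Memory} (h : Marks i D s s')
    (h' : Marks i D' s' s'') : Marks i (D ++ D') s s'' where
  arr a ha := (h'.arr a ha).trans (h.arr a ha)
  reg r hr := (h'.reg r hr).trans (h.reg r hr)
  mark x := by
    rw [h'.mark, h.mark]
    by_cases h1 : x ∈ D <;> by_cases h2 : x ∈ D' <;> simp [h1, h2]

theorem Marks.setPtr (i : ℕ) (s : Memory) (p : ℕ) : Marks i [] s (s.setReg rPtr p) where
  arr _ _ := rfl
  reg r hr := by simp [Memory.setReg, Function.update_of_ne hr]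
  mark x := by simp [Memory.setReg]

/-- Forbidding a character under a condition. -/
theorem runs_forbid {s : Memory} {test pos : Expr} :
    Runs (.ite test (forbidCharAt pos) .skip) s (test.cost + (pos.cost + 3) + 1) fun s' =>
      Marks (s.reg rI) (if test.eval s ≠ 0 then [s.arr aOut (pos.eval s)] else []) s s' ∧
        s'.reg rPtr = s.reg rPtr := by
  refine Runs.ite (fun h => ?_) (fun h => ?_)
  · unfold forbidCharAt
    refine (Runs.store ?_).mono (by simp [Expr.cost]) fun _ h => h
    rw [if_pos h]
    refine ⟨⟨fun a ha => ?_, fun r _ => rfl, fun x => ?_⟩, rfl⟩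
    · simp [Memory.setArr, Function.update_of_ne ha]
    · simp [Memory.setArr, Expr.eval, Function.update_apply]
  · refine (Runs.skip ?_).mono (by omega) fun _ h => h
    rw [if_neg (by simpa using h)]
    exact ⟨Marks.refl _ _, rfl⟩

/-- The characters that precede the palindromes listed in `l`. -/
def precedingChars (L : List (ℕ × ℕ)) (o : ℕ → ℕ) : List ℕ → List ℕ
  | [] => []
  | k :: l => (if 2 ≤ (L.getD k (0, 0)).1 then [o ((L.getD k (0, 0)).1 - 1)] else []) ++
      precedingChars L o l

theorem length_precedingChars_le (L : List (ℕ × ℕ)) (o : ℕ → ℕ) (l : List ℕ) :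
    (precedingChars L o l).length ≤ l.length := by
  induction l with
  | nil => simp [precedingChars]
  | cons k l ih =>
    rw [precedingChars, List.length_append, List.length_cons]
    split_ifs
    · simp only [List.length_singleton]; omega
    · simp only [List.length_nil]; omega

theorem mem_precedingChars {L : List (ℕ × ℕ)} {o : ℕ → ℕ} {l : List ℕ} {x : ℕ} :
    x ∈ precedingChars L o l ↔
      ∃ k ∈ l, 2 ≤ (L.getD k (0, 0)).1 ∧ o ((L.getD k (0, 0)).1 - 1) = x := by
  induction l with
  | nil => simp [precedingChars]
  | cons k l ih =>
    rw [precedingChars, List.mem_append, ih, List.exists_mem_cons_iff]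
    refine or_congr_left ?_
    split_ifs with h
    · rw [List.mem_singleton, and_iff_right h, eq_comm]
    · exact iff_of_false List.not_mem_nil fun h' => h h'.1

/-- The traversal of a linked list of palindromes in the free step. -/
def forbidLoop : Cmd := .loop (.reg rPtr) (block [
    .ite (.le (.const 2) (.get aStart (.sub (.reg rPtr) (.const 1))))
      (forbidCharAt (.sub (.get aStart (.sub (.reg rPtr) (.const 1))) (.const 1))) .skip,
    .assign rPtr (.get aNext (.sub (.reg rPtr) (.const 1)))])

theorem runs_forbidLoop {L : List (ℕ × ℕ)} {l : List ℕ} {s : Memory}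
    (hstart : ∀ k, s.arr aStart k = (L.getD k (0, 0)).1)
    (hl : Linked (s.arr aNext) (s.reg rPtr) l) :
    Runs forbidLoop s (40 * (l.length + 1))
      (Marks (s.reg rI) (precedingChars L (s.arr aOut) l) s) := by
  induction l generalizing s with
  | nil =>
    exact (Runs.loop_done (test := .reg rPtr) (s := s) hl (Marks.refl _ _)).mono (by simp [Expr.cost]) fun _ h => h
  | cons k l ih =>
    obtain ⟨hp, hl⟩ := hl
    refine (Runs.loop_step (t₁ := 30) (t₂ := 40 * (l.length + 1))
      (P := fun s' => Marks (s.reg rI) (precedingChars L (s.arr aOut) [k]) s s' ∧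
        s'.reg rPtr = s.arr aNext k) ?_ ?_ ?_).mono ?_ fun _ h => h
    · simp only [Expr.eval, hp]
      omega
    · simp only [block]
      refine (Runs.seq runs_forbid fun s' hs' => Runs.assign_seq (Runs.skip ?_)).mono
        (by simp [Expr.cost]) fun _ h => h
      obtain ⟨hm, hptr⟩ := hs'
      have heval : (Expr.get aStart (.sub (.reg rPtr) (.const 1))).eval s =
          (L.getD k (0, 0)).1 := by
        simp only [Expr.eval, hp, Nat.add_sub_cancel, hstart]
      refine ⟨?_, ?_⟩
      · have h2 := hm.trans (Marks.setPtr (s.reg rI) s'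
          ((Expr.get aNext (.sub (.reg rPtr) (.const 1))).eval s'))
        convert h2 using 2
        rw [precedingChars, precedingChars]
        congr 1
        have hpos : (Expr.sub (.get aStart (.sub (.reg rPtr) (.const 1))) (.const 1)).eval s =
            (L.getD k (0, 0)).1 - 1 := congrArg (· - 1) heval
        have htest := Expr.eval_le_ne_zero_iff (s := s) (e₁ := .const 2)
          (e₂ := .get aStart (.sub (.reg rPtr) (.const 1)))
        rw [heval, Expr.eval] at htest
        simp only [htest, hpos]
      · simp only [Memory.setReg, Function.update_self, Expr.eval, hptr, hp, Nat.add_sub_cancel]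
        rw [hm.arr _ (by decide)]
    · rintro s' ⟨hm, hptr⟩
      have h3 := ih (s := s')
        (fun k => by rw [hm.arr _ (by decide)]; exact hstart k)
        (by rw [hm.arr _ (by decide), hptr]; exact hl)
      rw [hm.arr aOut (by decide), hm.reg rI (by decide)] at h3
      refine h3.mono le_rfl fun s'' h4 => ?_
      have h5 := hm.trans h4
      rwa [precedingChars, precedingChars, List.append_nil] at h5
    · simp [Expr.cost]
      omega

/-- The characters that the free step forbids at position `i`, where the palindromes listed in `l`
end just before `i`. -/
def forbiddenChars (L : List (ℕ × ℕ)) (o : ℕ → ℕ) (i : ℕ) (l : List ℕ) : List ℕ :=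
  (if 2 ≤ i then [o (i - 1)] else []) ++
    ((if 3 ≤ i then [o (i - 2)] else []) ++ precedingChars L o l)

theorem length_forbiddenChars_le (L : List (ℕ × ℕ)) (o : ℕ → ℕ) (i : ℕ) (l : List ℕ) :
    (forbiddenChars L o i l).length ≤ l.length + 2 := by
  have := length_precedingChars_le L o l
  simp only [forbiddenChars, List.length_append]
  split_ifs <;> simp only [List.length_singleton, List.length_nil] <;> omega

/-- Some number not in the list `D` is smaller than all others and at most the length of `D`. -/
theorem exists_isLeast_notMem (D : List ℕ) : ∃ c, IsLeast {x | x ∉ D} c ∧ c ≤ D.length := by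
  classical
  have hne : ∃ x, x ∉ D := by
    obtain ⟨x, hx⟩ := Infinite.exists_notMem_finset D.toFinset
    exact ⟨x, fun h => hx (List.mem_toFinset.2 h)⟩
  refine ⟨Nat.find hne, ⟨Nat.find_spec hne, fun x hx => Nat.find_min' hne hx⟩, ?_⟩
  have hsub : Finset.range (Nat.find hne) ⊆ D.toFinset := fun x hx => by
    have := Nat.find_min hne (Finset.mem_range.1 hx)
    exact List.mem_toFinset.2 (not_not.1 this)
  have := Finset.card_le_card hsub
  rw [Finset.card_range] at this
  exact this.trans (List.toFinset_card_le D)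

/-- Old marks are smaller than `i`, so a cell equals `i` exactly when its character was forbidden in
this step. The search for a character makes `c` rounds, and `c` is at most the number of forbidden
characters, hence at most `l.length + 2`. -/
theorem runs_freeStep {L : List (ℕ × ℕ)} {l : List ℕ} {s : Memory} {i : ℕ}
    (hstart : ∀ k, s.arr aStart k = (L.getD k (0, 0)).1)
    (hl : Linked (s.arr aNext) (s.arr aHead (i - 1)) l) (hi : s.reg rI = i)
    (hmark : ∀ x, s.arr aMark x < i) :
    Runs freeStep s (200 * (l.length + 1)) fun s' => ∃ c,
      IsLeast {x | x ∉ forbiddenChars L (s.arr aOut) i l} c ∧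
      s'.arr aOut = Function.update (s.arr aOut) i c ∧
      (∀ a, a ≠ aMark → a ≠ aOut → s'.arr a = s.arr a) ∧
      (∀ r, r ≠ rPtr → r ≠ rX → s'.reg r = s.reg r) ∧
      ∀ x, s'.arr aMark x ≤ i := by
  obtain ⟨c, hc, hcl⟩ := exists_isLeast_notMem (forbiddenChars L (s.arr aOut) i l)
  have hlen := length_forbiddenChars_le L (s.arr aOut) i l
  unfold freeStep
  simp only [block]
  refine (Runs.seq runs_forbid fun s₁ h₁ => Runs.seq runs_forbid fun s₂ h₂ =>
    Runs.assign_seq (Runs.seq (P := Marks i (forbiddenChars L (s.arr aOut) i l) s)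
      (t₁ := 40 * (l.length + 1)) ?_ fun s₃ h₃ =>
    Runs.assign_seq (Runs.seq (Runs.loop (w := fun _ => 4) (N := c)
      (I := fun k s' => s' = s₃.setReg rX k) ?_ ?_ rfl) fun s₄ h₄ =>
    Runs.store_seq (Runs.skip ?_)))).mono ?_ fun _ h => h
  · obtain ⟨h₁, -⟩ := h₁
    obtain ⟨h₂, -⟩ := h₂
    have hi₁ : s₁.reg rI = i := (h₁.reg rI (by decide)).trans hi
    have hi₂ : s₂.reg rI = i := (h₂.reg rI (by decide)).trans hi₁
    rw [hi] at h₁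
    rw [hi₁] at h₂
    have h₃ := (h₁.trans h₂).trans (Marks.setPtr i s₂
      ((Expr.get aHead (.sub (.reg rI) (.const 1))).eval s₂))
    have h₄ := runs_forbidLoop (L := L) (l := l)
      (s := s₂.setReg rPtr ((Expr.get aHead (.sub (.reg rI) (.const 1))).eval s₂))
      (fun k => by rw [h₃.arr _ (by decide)]; exact hstart k) (by
        rw [h₃.arr _ (by decide)]
        simp only [Memory.setReg, Function.update_self, Expr.eval, hi₂]
        rwa [h₂.arr _ (by decide), h₁.arr _ (by decide)])
    refine h₄.mono le_rfl fun s' h₅ => ?_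
    rw [h₃.reg rI (by decide), hi] at h₅
    convert h₃.trans h₅ using 1
    rw [h₃.arr aOut (by decide), forbiddenChars, List.append_nil, List.append_assoc]
    congr 1
    · simp only [Expr.eval, hi]
      split_ifs <;> simp_all
    · congr 1
      simp only [Expr.eval, hi₁, h₁.arr aOut (by decide)]
      split_ifs <;> simp_all
  · rintro k s' hk rfl
    have hkD : k ∈ forbiddenChars L (s.arr aOut) i l := by
      by_contra h
      exact absurd (hc.2 h) (by omega)
    have hk' : s₃.arr aMark k = i := by rw [h₃.mark, if_pos hkD]
    refine ⟨?_, Runs.assign ?_⟩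
    · simp [Expr.eval, Memory.setReg, hk', h₃.reg rI, hi]
    · simp [Expr.eval, Memory.setReg]
  · rintro s' rfl
    have hk' : s₃.arr aMark c ≠ i := by
      rw [h₃.mark, if_neg hc.1]
      exact (hmark c).ne
    simp [Expr.eval, Memory.setReg, hk', h₃.reg rI, hi]
  · subst h₄
    refine ⟨c, hc, ?_, fun a h1 h2 => ?_, fun r h1 h2 => ?_, fun x => ?_⟩
    · simp [Expr.eval, Memory.setReg, Memory.setArr, h₃.reg rI, hi, h₃.arr aOut]
    · simp [Memory.setReg, Memory.setArr, Function.update_of_ne h2, h₃.arr a h1]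
    · simp [Memory.setReg, Memory.setArr, Function.update_of_ne h2, h₃.reg r h1]
    · simp only [Memory.setReg, Memory.setArr]
      rw [Function.update_of_ne (by decide), h₃.mark]
      split_ifs
      · exact le_rfl
      · exact (hmark x).le
  · simp [Expr.cost]
    omega

/-! ### The second phase -/

/-- The greedy rule at position `i`, for the characters `o 1, o 2, …`. -/
def GreedyAt (F : Set (ℕ × ℕ)) (o : ℕ → ℕ) (i : ℕ) : Prop :=
  (∃ p ∈ F, InRightHalf p i ∧ o i = o (p.1 + p.2 - i)) ∨
    ((∀ p ∈ F, ¬ InRightHalf p i) ∧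
      IsLeast {x | ¬ ∃ q, 1 ≤ q ∧ q < i ∧
        ((q + 1, i - 1) ∈ F ∨ q + 1 = i - 1 ∨ q + 1 = i) ∧ o q = x} (o i))

/-- The rule at `i` reads only positions up to `i`, so it survives writes to later cells. -/
theorem GreedyAt.congr {F : Set (ℕ × ℕ)} {o o' : ℕ → ℕ} {i : ℕ} (h : GreedyAt F o i)
    (heq : ∀ j ≤ i, o' j = o j) : GreedyAt F o' i := by
  rcases h with ⟨p, hp, hr, h⟩ | ⟨hr, h⟩
  · refine Or.inl ⟨p, hp, hr, ?_⟩
    have := hr.1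
    rw [heq i le_rfl, heq _ (by omega), h]
  · refine Or.inr ⟨hr, ?_⟩
    rw [heq i le_rfl]
    convert h using 1
    ext x
    refine not_congr (exists_congr fun q => and_congr_right fun _ => and_congr_right fun hq => ?_)
    rw [heq q (by omega)]

theorem charAt_outputString (s : Memory) {n j : ℕ} (h1 : 1 ≤ j) (hj : j ≤ n) :
    (outputString s n)[j - 1]? = some (s.arr aOut j) := by
  rw [outputString, List.getElem?_map, List.getElem?_range (by omega), Option.map_some,
    Nat.sub_add_cancel h1]

theorem isGreedyReconstruction_outputString {F : Set (ℕ × ℕ)} {n : ℕ} {s : Memory}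
    (hF : ∀ p ∈ F, 1 ≤ p.1) (h : ∀ i, 1 ≤ i → i ≤ n → GreedyAt F (s.arr aOut) i) :
    IsGreedyReconstruction F n (outputString s n) := by
  refine ⟨by simp [outputString], fun i h1 hi => ?_⟩
  rcases h i h1 hi with ⟨p, hp, hr, h⟩ | ⟨hr, h⟩
  · refine Or.inl ⟨p, hp, hr, ?_⟩
    have hp1 := hF p hp
    have hr1 := hr.1
    have hr2 := hr.2
    rw [charAt_outputString s h1 hi, charAt_outputString s (by omega) (by omega), h]
  · refine Or.inr ⟨hr, _, charAt_outputString s h1 hi, ?_⟩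
    convert h using 1
    ext x
    refine not_congr (exists_congr fun q => and_congr_right fun hq1 => and_congr_right fun hq =>
      and_congr_right fun _ => ?_)
    rw [charAt_outputString s hq1 (by omega), Option.some_inj]

/-- The registers describe the palindrome that reaches furthest to the right among those for which
the sum of start and end is less than `b`. -/
structure Reach (L : List (ℕ × ℕ)) (b : ℕ) (s : Memory) : Prop where
  le : ∀ p ∈ L, p.1 + p.2 < b → p.2 ≤ s.reg rEnd
  attained : s.reg rEnd = 0 ∨
    ∃ p ∈ L, p.1 + p.2 < b ∧ p.2 = s.reg rEnd ∧ p.1 + p.2 = s.reg rSum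

/-- The center array describes the pairs of `L`. -/
structure Centers (L : List (ℕ × ℕ)) (cen : ℕ → ℕ) : Prop where
  eq : ∀ p ∈ L, cen (p.1 + p.2) = p.2
  exists_of_ne : ∀ c, cen c ≠ 0 → ∃ p ∈ L, p.1 + p.2 = c ∧ p.2 = cen c

/-- The expression `sum` is evaluated again after `rEnd` has been overwritten; `hsum'` says that its
value does not change. -/
theorem runs_tryCenter {L : List (ℕ × ℕ)} {s : Memory} {b : ℕ} {sum : Expr}
    (hcost : sum.cost = 5) (hsum : sum.eval s = b)
    (hsum' : ∀ v, sum.eval (s.setReg rEnd v) = b) (hC : Centers L (s.arr aCen))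
    (hR : Reach L b s) :
    Runs (tryCenter sum) s 40 fun s' => s'.arr = s.arr ∧
      (∀ r, r ≠ rEnd → r ≠ rSum → s'.reg r = s.reg r) ∧ Reach L (b + 1) s' := by
  unfold tryCenter
  refine (Runs.ite (t := 20) (fun h => ?_) (fun h => ?_)).mono (by simp [Expr.cost, hcost])
    fun _ h => h
  · have hlt : s.reg rEnd < s.arr aCen b := by
      by_contra hlt
      refine h ?_
      simp only [Expr.eval, hsum]
      rw [if_neg (by omega)]
    simp only [block]
    refine (Runs.assign_seq (Runs.assign_seq (Runs.skip ?_))).mono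
      (by simp [Expr.cost, hcost]) fun _ h => h
    simp only [Expr.eval, hsum, hsum']
    refine ⟨rfl, fun r h1 h2 => ?_, ⟨fun p hp hpb => ?_, Or.inr ?_⟩⟩
    · simp [Memory.setReg, Function.update_of_ne h1, Function.update_of_ne h2]
    · have hreg : ((s.setReg rEnd (s.arr aCen b)).setReg rSum b).reg rEnd = s.arr aCen b := by
        simp [Memory.setReg]
      rw [hreg]
      rcases Nat.lt_succ_iff_lt_or_eq.1 hpb with hpb | rfl
      · exact (hR.le p hp hpb).trans hlt.le
      · exact (hC.eq p hp).ge
    · obtain ⟨p, hp, h1, h2⟩ := hC.exists_of_ne b (by omega)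
      exact ⟨p, hp, by omega, by simp [Memory.setReg, h2], by simp [Memory.setReg, h1]⟩
  · have hle : s.arr aCen b ≤ s.reg rEnd := by
      by_contra hlt
      simp only [Expr.eval, hsum] at h
      rw [if_pos (by omega)] at h
      exact one_ne_zero h
    refine (Runs.skip ⟨rfl, fun r _ _ => rfl, ⟨fun p hp hpb => ?_, ?_⟩⟩).mono (by omega)
      fun _ h => h
    · rcases Nat.lt_succ_iff_lt_or_eq.1 hpb with hpb | rfl
      · exact hR.le p hp hpb
      · exact (hC.eq p hp).ge.trans hle
    · refine hR.attained.imp_right ?_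
      rintro ⟨p, hp, h1, h2⟩
      exact ⟨p, hp, by omega, h2⟩

/-- The arrays that the first phase prepares for the second one. -/
structure Indexed (L : List (ℕ × ℕ)) (s : Memory) : Prop where
  start : ∀ k, s.arr aStart k = (L.getD k (0, 0)).1
  cen : Centers L (s.arr aCen)
  links : ∀ e, Linked (s.arr aNext) (s.arr aHead e) (endIdx L L.length e)

theorem Indexed.congr {L : List (ℕ × ℕ)} {s s' : Memory} (h : Indexed L s)
    (heq : ∀ a, a ≠ aMark → a ≠ aOut → s'.arr a = s.arr a) : Indexed L s' where
  start := by rw [heq aStart (by decide) (by decide)]; exact h.start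
  cen := by rw [heq aCen (by decide) (by decide)]; exact h.cen
  links := by
    rw [heq aNext (by decide) (by decide), heq aHead (by decide) (by decide)]
    exact h.links

/-- The memory after `k` rounds of the second phase. -/
structure WriteInv (L : List (ℕ × ℕ)) (n k : ℕ) (s : Memory) : Prop where
  regN : s.reg rN = n
  regI : s.reg rI = k + 1
  indexed : Indexed L s
  reach : Reach L (2 * k) s
  mark : ∀ x, s.arr aMark x ≤ k
  greedy : ∀ j, 1 ≤ j → j ≤ k → GreedyAt {p | p ∈ L} (s.arr aOut) j

/-- A palindrome that starts at position 1 has no preceding character, which is why the list skips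
starts below 2 while the rule asks for `1 ≤ q`. -/
theorem mem_forbiddenChars_iff {L : List (ℕ × ℕ)} (hL : ∀ p ∈ L, p.1 < p.2) {o : ℕ → ℕ}
    {i x : ℕ} : x ∈ forbiddenChars L o i (endIdx L L.length (i - 1)) ↔
      ∃ q, 1 ≤ q ∧ q < i ∧ ((q + 1, i - 1) ∈ L ∨ q + 1 = i - 1 ∨ q + 1 = i) ∧ o q = x := by
  simp only [forbiddenChars, List.mem_append, mem_precedingChars, mem_endIdx]
  constructor
  · rintro (h | h | ⟨k, ⟨hk, he⟩, hs, h⟩)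
    · split_ifs at h with hi
      · exact ⟨i - 1, by omega, by omega, by omega, (List.mem_singleton.1 h).symm⟩
      · exact absurd h List.not_mem_nil
    · split_ifs at h with hi
      · exact ⟨i - 2, by omega, by omega, by omega, (List.mem_singleton.1 h).symm⟩
      · exact absurd h List.not_mem_nil
    · have hmem : L.getD k (0, 0) ∈ L := by
        rw [List.getD_eq_getElem _ _ hk]
        exact List.getElem_mem hk
      have hlt := hL _ hmem
      refine ⟨(L.getD k (0, 0)).1 - 1, by omega, by omega, Or.inl ?_, h⟩
      rw [Nat.sub_add_cancel (by omega), ← he]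
      exact hmem
  · rintro ⟨q, hq1, hqi, h | h | h, rfl⟩
    · obtain ⟨k, hk, he⟩ := List.getElem_of_mem h
      refine Or.inr (Or.inr ⟨k, ?_⟩)
      rw [List.getD_eq_getElem _ _ hk, he]
      exact ⟨⟨hk, rfl⟩, by simp only; omega, rfl⟩
    · right; left
      rw [if_pos (by omega), show i - 2 = q by omega]
      exact List.mem_singleton_self _
    · left
      rw [if_pos (by omega), show i - 1 = q by omega]
      exact List.mem_singleton_self _

/-- The body of the main loop of the second phase. -/
def writeStep : Cmd := block [
    tryCenter (.sub (.add (.reg rI) (.reg rI)) (.const 2)),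
    tryCenter (.sub (.add (.reg rI) (.reg rI)) (.const 1)),
    .ite (.le (.reg rI) (.reg rEnd))
      (.store aOut (.reg rI) (.get aOut (.sub (.reg rSum) (.reg rI))))
      freeStep,
    .assign rI (.add (.reg rI) (.const 1))]

theorem GreedyAt.of_le_update {F : Set (ℕ × ℕ)} {o : ℕ → ℕ} {k v : ℕ}
    (h : ∀ j, 1 ≤ j → j ≤ k → GreedyAt F o j)
    (hk : GreedyAt F (Function.update o (k + 1) v) (k + 1)) :
    ∀ j, 1 ≤ j → j ≤ k + 1 → GreedyAt F (Function.update o (k + 1) v) j := by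
  intro j h1 hj
  rcases hj.eq_or_lt with rfl | hj
  · exact hk
  · exact (h j h1 (by omega)).congr fun q hq => Function.update_of_ne (by omega) _ _

theorem runs_writeStep {L : List (ℕ × ℕ)} {n k : ℕ} {s : Memory}
    (hL : ∀ p ∈ L, 1 ≤ p.1 ∧ p.1 < p.2) (h : WriteInv L n k s) :
    Runs writeStep s (300 * ((endIdx L L.length k).length + 1)) (WriteInv L n (k + 1)) := by
  unfold writeStep
  simp only [block]
  refine (Runs.seq (runs_tryCenter (b := 2 * k) rfl ?_ ?_ h.indexed.cen h.reach) fun s₁ h₁ =>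
    Runs.seq (runs_tryCenter (L := L) (b := 2 * k + 1) rfl ?_ ?_ ?_ h₁.2.2) fun s₂ h₂ =>
    Runs.seq (P := fun s' => (∀ a, a ≠ aMark → a ≠ aOut → s'.arr a = s₂.arr a) ∧
        (∀ r, r ≠ rPtr → r ≠ rX → s'.reg r = s₂.reg r) ∧ (∀ x, s'.arr aMark x ≤ k + 1) ∧
        ∀ j, 1 ≤ j → j ≤ k + 1 → GreedyAt {p | p ∈ L} (s'.arr aOut) j)
      (Runs.ite (t := 200 * ((endIdx L L.length k).length + 1)) ?_ ?_) fun s₃ h₃ =>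
    Runs.assign_seq (Runs.skip ?_)).mono ?_ fun _ h => h
  · simp only [Expr.eval, h.regI]; omega
  · intro v
    have : (s.setReg rEnd v).reg rI = k + 1 := by simp [Memory.setReg, h.regI]
    simp only [Expr.eval, this]; omega
  · have : s₁.reg rI = k + 1 := by rw [h₁.2.1 rI (by decide) (by decide), h.regI]
    simp only [Expr.eval, this]; omega
  · intro v
    have : s₁.reg rI = k + 1 := by rw [h₁.2.1 rI (by decide) (by decide), h.regI]
    have : (s₁.setReg rEnd v).reg rI = k + 1 := by simp [Memory.setReg, this]
    simp only [Expr.eval, this]; omega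
  · rw [h₁.1]; exact h.indexed.cen
  -- The step count is settled first; the three goals left share the facts about `s₂` collected
  -- next.
  rotate_right
  · simp [Expr.cost]
    omega
  all_goals
    have harr : s₂.arr = s.arr := h₂.1.trans h₁.1
    have hI : s₂.reg rI = k + 1 := by
      rw [h₂.2.1 rI (by decide) (by decide), h₁.2.1 rI (by decide) (by decide), h.regI]
    have hN : s₂.reg rN = n := by
      rw [h₂.2.1 rN (by decide) (by decide), h₁.2.1 rN (by decide) (by decide), h.regN]
    have hR : Reach L (2 * k + 1 + 1) s₂ := h₂.2.2
  · intro htest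
    have hle : k + 1 ≤ s₂.reg rEnd := by
      by_contra hlt
      refine htest ?_
      simp only [Expr.eval, hI]
      rw [if_neg hlt]
    -- A recorded end of at least `k + 1` belongs to an actual pair, with sum below `2 * (k + 1)`;
    -- so `k + 1` lies in its right half.
    obtain h0 | ⟨p, hp, hp1, hp2, hp3⟩ := hR.attained
    · omega
    have hval := hL p hp
    refine (Runs.store ?_).mono (by simp [Expr.cost]; omega) fun _ h => h
    simp only [Expr.eval, hI, harr, ← hp3]
    refine ⟨fun a _ h2 => ?_, fun r _ _ => rfl, fun x => ?_, ?_⟩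
    · simp [Memory.setArr, Function.update_of_ne h2, harr]
    · simp only [Memory.setArr, harr]
      rw [Function.update_of_ne (by decide)]
      exact (h.mark x).trans (by omega)
    · simp only [Memory.setArr, harr, Function.update_self]
      refine GreedyAt.of_le_update h.greedy (Or.inl ⟨p, hp, ⟨by omega, by omega⟩, ?_⟩)
      -- The mirror image lies strictly before `k + 1`, so the write does not change the character
      -- copied.
      rw [Function.update_self, Function.update_of_ne (by omega)]
  · intro htest
    have hlt : s₂.reg rEnd < k + 1 := by
      by_contra hle
      simp only [Expr.eval, hI] at htest
      rw [if_pos (by omega)] at htest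
      exact one_ne_zero htest
    refine (runs_freeStep (L := L) (l := endIdx L L.length k) (i := k + 1) ?_ ?_ hI ?_).mono
      le_rfl ?_
    · rw [harr]; exact h.indexed.start
    · rw [harr]; exact h.indexed.links k
    · rw [harr]; exact fun x => Nat.lt_succ_of_le (h.mark x)
    · rintro s' ⟨c, hc, hout, ha, hr, hm⟩
      refine ⟨ha, hr, hm, ?_⟩
      rw [hout, harr]
      refine GreedyAt.of_le_update h.greedy (Or.inr ⟨fun p hp hpr => ?_, ?_⟩)
      -- A palindrome with `k + 1` in its right half has sum below `2 * (k + 1)`, so the recorded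
      -- end bounds its end.
      · have h1 := hR.le p hp (by have := hpr.1; omega)
        have h2 := hpr.2
        omega
      · rw [Function.update_self]
        convert hc using 1
        ext x
        refine not_congr (Iff.trans ?_ (mem_forbiddenChars_iff (i := k + 1)
          fun p hp => (hL p hp).2).symm)
        refine exists_congr fun q => and_congr_right fun _ =>
          and_congr_right fun hq => and_congr_right fun _ => ?_
        rw [Function.update_of_ne (by omega), harr]
  · obtain ⟨ha, hr, hm, hg⟩ := h₃
    constructor
    · simp [Memory.setReg, hr rN, hN]
    · simp [Memory.setReg, Expr.eval, hr rI, hI]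
    · refine h.indexed.congr fun a h1 h2 => ?_
      rw [← harr]
      exact ha a h1 h2
    · have he : ((s₃.setReg rI ((Expr.add (.reg rI) (.const 1)).eval s₃)).reg rEnd) =
          s₂.reg rEnd := by simp [Memory.setReg, hr rEnd]
      have hs : ((s₃.setReg rI ((Expr.add (.reg rI) (.const 1)).eval s₃)).reg rSum) =
          s₂.reg rSum := by simp [Memory.setReg, hr rSum]
      exact ⟨by rw [he]; exact hR.le, by rw [he, hs]; exact hR.attained⟩
    · exact hm
    · exact hg

theorem IndexInv.indexed {L : List (ℕ × ℕ)} {n : ℕ} {s : Memory} (h : IndexInv L n L.length s)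
    (hinj : ∀ p ∈ L, ∀ q ∈ L, p.1 + p.2 = q.1 + q.2 → p = q) : Indexed L s where
  start := h.start
  links := h.links
  cen := by
    have hmem : ∀ k < L.length, L.getD k (0, 0) ∈ L := fun k hk => by
      rw [List.getD_eq_getElem _ _ hk]
      exact List.getElem_mem hk
    refine ⟨fun p hp => ?_, fun c hc => ?_⟩
    · rcases h.cen (p.1 + p.2) with ⟨-, h2⟩ | ⟨k, hk, h2, h3⟩
      · obtain ⟨k, hk, rfl⟩ := List.getElem_of_mem hp
        exact absurd (by rw [List.getD_eq_getElem _ _ hk]) (h2 k hk)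
      -- The cell holds the end of some pair with this sum; injectivity of the sum makes it the pair
      -- `p`.
      · rw [h3, hinj _ (hmem k hk) p hp h2]
    · rcases h.cen c with ⟨h1, -⟩ | ⟨k, hk, h2, h3⟩
      · exact absurd h1 hc
      · exact ⟨_, hmem k hk, h2, h3.symm⟩

theorem runs_writePhase {L : List (ℕ × ℕ)} {n : ℕ} {s : Memory}
    (hL : ∀ p ∈ L, 1 ≤ p.1 ∧ p.1 < p.2) (hinj : ∀ p ∈ L, ∀ q ∈ L, p.1 + p.2 = q.1 + q.2 → p = q)
    (h : IndexInv L n L.length s) :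
    Runs writePhase s (300 * L.length + 400 * (n + 1)) (WriteInv L n n) := by
  have hstep : writePhase = block [.assign rSum (.const 0), .assign rEnd (.const 0),
    .assign rI (.const 1), .loop (.le (.reg rI) (.reg rN)) writeStep] := rfl
  rw [hstep]
  simp only [block]
  refine (Runs.assign_seq (Runs.assign_seq (Runs.assign_seq (Runs.seq (Runs.loop
    (w := fun k => 300 * ((endIdx L L.length k).length + 1)) (N := n)
    (I := WriteInv L n) ?_ ?_ ?_) fun s hs => Runs.skip hs)))).mono ?_ fun _ h => h
  · intro k s hk h
    refine ⟨?_, runs_writeStep hL h⟩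
    simp only [Expr.eval, h.regI, h.regN]
    rw [if_pos (by omega)]
    exact one_ne_zero
  · intro s h
    simp only [Expr.eval, h.regI, h.regN]
    rw [if_neg (by omega)]
  · constructor
    · simp [Memory.setReg, h.regN]
    · simp [Memory.setReg, Expr.eval]
    · exact (h.indexed hinj).congr fun _ _ _ => rfl
    · exact ⟨fun p _ hp => by omega, Or.inl (by simp [Memory.setReg, Expr.eval])⟩
    · intro x
      simp [Memory.setReg, h.mark]
    · intro j h1 h2
      omega
  · have := sum_length_endIdx_le L L.length n
    rw [← Finset.mul_sum, Finset.sum_add_distrib]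
    simp [Expr.cost]
    omega

/-! ### The linear bound for the whole program. -/

/-- Since `b < e ≤ n`, all the sums `b + e` are below `2 * n`. -/
theorem length_le_of_sum_injective {L : List (ℕ × ℕ)} {n : ℕ} (hnd : L.Nodup)
    (hL : ∀ p ∈ L, p.1 < p.2 ∧ p.2 ≤ n)
    (hinj : ∀ p ∈ L, ∀ q ∈ L, p.1 + p.2 = q.1 + q.2 → p = q) : L.length ≤ 2 * n := by
  classical
  rw [← List.toFinset_card_of_nodup hnd, ← Finset.card_range (2 * n)]
  refine Finset.card_le_card_of_injOn (fun p => p.1 + p.2) (fun p hp => ?_) fun p hp q hq h => ?_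
  · have := hL p (by simpa using hp)
    simp only [Finset.coe_range, Set.mem_Iio]
    omega
  · exact hinj p (by simpa using hp) q (by simpa using hq) h

theorem runs_greedyProgram {α : Type*} {L : List (ℕ × ℕ)} {n : ℕ} {T : List α} (hnd : L.Nodup)
    (hT : IsPreimage {p | p ∈ L} n T) :
    Runs greedyProgram (inputMemory L n) (1200 * (n + 1)) fun s =>
      IsGreedyReconstruction {p | p ∈ L} n (outputString s n) := by
  have hmem : ∀ p, p ∈ L ↔ p ∈ PF T := fun p => by rw [hT.2]; rfl
  have hL : ∀ p ∈ L, 1 ≤ p.1 ∧ p.1 < p.2 ∧ p.2 ≤ n := fun p hp => by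
    have := (mem_PF_iff T p.1 p.2).1 ((hmem p).1 hp)
    rw [← hT.1]
    exact ⟨this.1, this.2.1, this.2.2.1⟩
  have hinj : ∀ p ∈ L, ∀ q ∈ L, p.1 + p.2 = q.1 + q.2 → p = q := fun p hp q hq =>
    eq_of_mem_PF_of_add_eq ((hmem p).1 hp) ((hmem q).1 hq)
  have hlen := length_le_of_sum_injective hnd (fun p hp => (hL p hp).2) hinj
  -- With at most `2 * n` pairs, the phases take at most `50 * (2 * n + 1)` and `600 * n + 400 * (n
  -- + 1)` steps.
  refine (Runs.seq (runs_indexPhase L n) fun s hs => runs_writePhase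
    (fun p hp => ⟨(hL p hp).1, (hL p hp).2.1⟩) hinj hs).mono (by omega) fun s hs => ?_
  exact isGreedyReconstruction_outputString (fun p hp => (hL p hp).1) hs.greedy

end PalFingerprint

theorem mainTheorem4 :
    -- every greedy reconstruction of a valid fingerprint is a preimage over a minimum alphabet
    (∀ (n : ℕ) (F : Set (ℕ × ℕ)), PalFingerprint.IsValid.{u} F n →
      ∀ S : List ℕ, PalFingerprint.IsGreedyReconstruction F n S →
        PalFingerprint.IsPreimage F n S ∧
        ∀ (β : Type v) (T : List β), PalFingerprint.IsPreimage F n T →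
          PalFingerprint.alphabetSize S ≤ PalFingerprint.alphabetSize T) ∧
    -- the program halts in linear time on a valid fingerprint, listed in any order,
    -- and its output is the greedy reconstruction, hence a preimage over a minimum alphabet
    (∃ C : ℕ, ∀ (n : ℕ) (L : List (ℕ × ℕ)), L.Nodup →
      PalFingerprint.IsValid.{u} {p | p ∈ L} n →
        ∃ (t : ℕ) (s : PalFingerprint.Memory),
          PalFingerprint.Exec PalFingerprint.greedyProgram
            (PalFingerprint.inputMemory L n) t s ∧
          t ≤ C * (n + 1) ∧
          PalFingerprint.IsGreedyReconstruction {p | p ∈ L} n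
            (PalFingerprint.outputString s n) ∧
          PalFingerprint.IsPreimage {p | p ∈ L} n (PalFingerprint.outputString s n) ∧
          ∀ (β : Type v) (T : List β), PalFingerprint.IsPreimage {p | p ∈ L} n T →
            PalFingerprint.alphabetSize (PalFingerprint.outputString s n) ≤
              PalFingerprint.alphabetSize T) := by
  refine ⟨fun n F ⟨α, T, hT⟩ S hS => ⟨hS.isPreimage hT, fun β T' hT' => hS.alphabetSize_le hT'⟩,
    1200, fun n L hnd ⟨α, T, hT⟩ => ?_⟩
  obtain ⟨t, s, hexec, ht, hS⟩ := PalFingerprint.runs_greedyProgram hnd hT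
  exact ⟨t, s, hexec, ht, hS, hS.isPreimage hT, fun β T' hT' => hS.alphabetSize_le hT'⟩
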